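/- There is a universal constant $c_0>1$ for which the following holds. Let $\mathbb G$ be any compact group and $\pi:\mathbb G\to U(d)$ any continuous $d$-dimensional unitary representation. Let $p_n,q_n\in[0,1]$ and $\sigma_n\ge 0$ be sequences. For each $n$ let $g_1,\dots,g_n$ be (possibly random, possibly depending on $n$) elements of $\mathbb G$, and let $X\in\mathbb C^{nd\times d}$ be the block column with blocks $\pi(g_1),\dots,\pi(g_n)$. Let $E,\Delta,\Pi,\mathcal E$ be random $nd\times nd$ Hermitian block matrices with $d\times d$ blocks, such that all blocks above the diagonal are independent (within and across the four matrices), jointly independent of $g_1,\dots,g_n$, and: - each block of $E$ (resp. $\Delta$) above the diagonal is all-ones with probability $q_n$ (resp. $p_n$) and zero otherwise, and the diagonal blocks of $E$ and $\Delta$ are all-ones; - each block of $\Pi$ above the diagonal is $\pi(h)$ with $h$ distributed by the normalized Haar measure of $\mathbb G$, and the diagonal blocks are zero; - each block of $\mathcal E$ above the diagonal has i.i.d. standard Gaussian entries (either all real, or all complex, i.e. $U+iV$ with $U,V$ independent $N(0,1/2)$), and the diagonal blocks are zero. All the variables, for all $n$, live on one probability space; nothing is assumed about the joint law for different $n$.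 Write $\odot$ for the entrywise product and $\overline\Delta=\mathbf 1\mathbf 1^*-\Delta$, and let $$Y_1=\frac{1}{nq_np_n}\Big[E\odot\Delta\odot(XX^*)+E\odot\Big(\overline\Delta\odot\Pi+\frac{\sigma_n}{\sqrt d}\mathcal E\Big)\Big],$$ $$Y_2=\frac1n XX^*+\frac{1}{nq_np_n}E\odot\Big(\overline\Delta\odot\Pi+\frac{\sigma_n}{\sqrt d}\mathcal E\Big).$$ If $p_nq_n=\omega(\log^{c_0}(n)/n)$, that is, $\log^{c_0}(n)/n=o(p_nq_n)$ as $n\to\infty$, then the operator norm satisfies $\|Y_1-Y_2\|\to 0$ almost surely as $n\to\infty$. -/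

import Mathlib

open Filter Topology Asymptotics MeasureTheory ProbabilityTheory Matrix

noncomputable section

namespace GroupSync

/-- The pairs `i < j` of vertices: the potential measurements. -/
abbrev Edge (n : ℕ) : Type := {e : Fin n × Fin n // e.1 < e.2}

/-- Complex `nd × nd` matrices, seen as `n × n` block matrices with `d × d` blocks:
the entry at `((i, a), (j, b))` is the `(a, b)` entry of the `(i, j)` block. -/
abbrev BlockMatrix (n d : ℕ) : Type := Matrix (Fin n × Fin d) (Fin n × Fin d) ℂ

/-- The Hermitian block matrix with given blocks `B e` above the block diagonal, the conjugate
transposes of these below it, and all diagonal blocks equal to `D` (a Hermitian matrix). -/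
def hermBlock {n d : ℕ} (D : Matrix (Fin d) (Fin d) ℂ)
    (B : Edge n → Matrix (Fin d) (Fin d) ℂ) : BlockMatrix n d :=
  Matrix.of fun x y =>
    if h : x.1 < y.1 then B ⟨(x.1, y.1), h⟩ x.2 y.2
    else if h : y.1 < x.1 then (B ⟨(y.1, x.1), h⟩)ᴴ x.2 y.2
    else D x.2 y.2

/-- The `d × d` all-ones block. -/
def onesBlock (d : ℕ) : Matrix (Fin d) (Fin d) ℂ := Matrix.of fun _ _ => 1

/-- The block mask (the matrices `E` and `Δ`) of an edge set: an off-diagonal block is all-ones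
if its edge is selected and zero otherwise; diagonal blocks are all-ones. -/
def mask {n : ℕ} (d : ℕ) (m : Edge n → Bool) : BlockMatrix n d :=
  hermBlock (onesBlock d) fun e => if m e then onesBlock d else 0

/-- The complement `𝟙𝟙* - M` of a block mask. -/
def complMask {n d : ℕ} (M : BlockMatrix n d) : BlockMatrix n d :=
  (Matrix.of fun _ _ => 1) - M

variable {G : Type*} [Group G] {d : ℕ}

/-- The signal `X`: the `nd × d` block column with blocks `π (g i)`. -/
def signal {n : ℕ} (π : G →* Matrix.unitaryGroup (Fin d) ℂ) (g : Fin n → G) :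
    Matrix (Fin n × Fin d) (Fin d) ℂ :=
  Matrix.of fun x b => (π (g x.1) : Matrix (Fin d) (Fin d) ℂ) x.2 b

/-- The outlier matrix `Π`: blocks `π (h e)` above the diagonal, zero diagonal blocks. -/
def outlierMatrix {n : ℕ} (π : G →* Matrix.unitaryGroup (Fin d) ℂ) (h : Edge n → G) :
    BlockMatrix n d :=
  hermBlock 0 fun e => (π (h e) : Matrix (Fin d) (Fin d) ℂ)

/-- The additive noise matrix `ℰ`: blocks `ε e` above the diagonal, zero diagonal blocks. -/
def additiveMatrix {n : ℕ} (ε : Edge n → Fin d → Fin d → ℂ) : BlockMatrix n d :=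
  hermBlock 0 fun e => Matrix.of (ε e)

/-- The noise part `E ⊙ (Δᶜ ⊙ Π + (σ / √d) ℰ)` of the measurement matrix. -/
def noisePart {n : ℕ} (π : G →* Matrix.unitaryGroup (Fin d) ℂ) (σ : ℝ)
    (e δ : Edge n → Bool) (h : Edge n → G) (ε : Edge n → Fin d → Fin d → ℂ) :
    BlockMatrix n d :=
  mask d e ⊙ (complMask (mask d δ) ⊙ outlierMatrix π h
    + ((σ / √(d : ℝ) : ℝ) : ℂ) • additiveMatrix ε)

/-- The measurement matrix `Y = E ⊙ Δ ⊙ XX* + E ⊙ (Δᶜ ⊙ Π + (σ / √d) ℰ)`. -/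
def measurement {n : ℕ} (π : G →* Matrix.unitaryGroup (Fin d) ℂ) (σ : ℝ) (g : Fin n → G)
    (e δ : Edge n → Bool) (h : Edge n → G) (ε : Edge n → Fin d → Fin d → ℂ) :
    BlockMatrix n d :=
  mask d e ⊙ mask d δ ⊙ (signal π g * (signal π g)ᴴ) + noisePart π σ e δ h ε

/-- `Y₁ = Y / (n q p)`. -/
def Y₁ {n : ℕ} (π : G →* Matrix.unitaryGroup (Fin d) ℂ) (p q : unitInterval) (σ : ℝ) (g : Fin n → G)
    (e δ : Edge n → Bool) (h : Edge n → G) (ε : Edge n → Fin d → Fin d → ℂ) :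
    BlockMatrix n d :=
  ((1 / ((n : ℝ) * (q : ℝ) * (p : ℝ)) : ℝ) : ℂ) • measurement π σ g e δ h ε

/-- `Y₂ = XX* / n + E ⊙ (Δᶜ ⊙ Π + (σ / √d) ℰ) / (n q p)`. -/
def Y₂ {n : ℕ} (π : G →* Matrix.unitaryGroup (Fin d) ℂ) (p q : unitInterval) (σ : ℝ) (g : Fin n → G)
    (e δ : Edge n → Bool) (h : Edge n → G) (ε : Edge n → Fin d → Fin d → ℂ) :
    BlockMatrix n d :=
  ((1 / (n : ℝ) : ℝ) : ℂ) • (signal π g * (signal π g)ᴴ)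
    + ((1 / ((n : ℝ) * (q : ℝ) * (p : ℝ)) : ℝ) : ℂ) • noisePart π σ e δ h ε

/-- The operator norm of a block matrix, acting on `ℂ^(nd)` with its Euclidean norm. -/
def opNorm {n : ℕ} (A : BlockMatrix n d) : ℝ :=
  ‖Matrix.toEuclideanCLM (𝕜 := ℂ) (n := Fin n × Fin d) A‖

/-- The standard real Gaussian law, seen on `ℂ`. -/
def realGaussian : Measure ℂ := (gaussianReal 0 1).map (fun x : ℝ => (x : ℂ))

/-- The standard complex Gaussian law: `X + iY` with `X, Y` independent `N(0, 1/2)`. -/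
def complexGaussian : Measure ℂ :=
  ((gaussianReal 0 (1 / 2)).prod (gaussianReal 0 (1 / 2))).map
    (fun z : ℝ × ℝ => (z.1 : ℂ) + (z.2 : ℂ) * Complex.I)

/-- The joint law of the corruption variables `(e, δ, h, ε)` on `n` vertices. All of them are
independent: an edge is available (`e`) with probability `q`, uncorrupted (`δ`) with probability
`p`, the outliers `h` are Haar distributed on `G`, and each of the `d × d` entries of each
additive noise block `ε` has law `γ`. -/
def corruptionLaw (n d : ℕ) (G : Type*) [Group G] [TopologicalSpace G] [IsTopologicalGroup G]
    [CompactSpace G] [MeasurableSpace G] [BorelSpace G] (p q : unitInterval) (γ : Measure ℂ) :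
    Measure ((Edge n → Bool) × (Edge n → Bool) × (Edge n → G)
      × (Edge n → Fin d → Fin d → ℂ)) :=
  (Measure.pi fun _ : Edge n => bernoulliMeasure true false q).prod
    ((Measure.pi fun _ : Edge n => bernoulliMeasure true false p).prod
      ((Measure.pi fun _ : Edge n =>
          Measure.haarMeasure (⊤ : TopologicalSpace.PositiveCompacts G)).prod
        (Measure.pi fun _ : Edge n => Measure.pi fun _ : Fin d => Measure.pi fun _ : Fin d => γ)))

end GroupSync

end

/-!
The noise parts cancel in `Y₁ - Y₂`. With `r = 1 / (p q)` and `b i j` the indicator that the edge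
`i j` is available and uncorrupted, the remaining `(i, j)` block is
`(r * b i j - 1) / n • π (g i) * (π (g j))ᴴ` off the diagonal and `(r - 1) / n • 1` on it
(`Y₁_sub_Y₂`). The diagonal part is at most `r / n → 0`. The off-diagonal part is `1 / n` times
`W ⊗ 1` conjugated by a block diagonal unitary, where the symmetric scalar matrix `W` has
independent centred entries; conjugation does not change traces of powers, so the group elements
disappear from the problem (`opNorm_blockTwist_pow_le`).

It remains to bound `‖W‖ / n`, by the method of moments. The trace of `W ^ (2 k)` is a sum over
walks (`pow_apply_eq_sum_walk`), and the expectation of a summand factors over the distinct edges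
of the walk. An edge used `m` times contributes `0` if `m = 1` and at most `r ^ (m - 1)` if
`m ≥ 2`. Both cases are covered by the bound `s ^ m * c` with `s ^ 2 * c = r` and `r ≤ s`, whose
product over the edges of the walk depends only on the number `N` of distinct edges: it is
`s ^ (2 k) * c ^ N`. Walks are counted one step at a time: a step either uses a new edge (`n`
choices, weight `c`) or repeats an old one (at most `2 k` choices), which gives
`∑ c ^ N ≤ n (c n + 2 k) ^ (2 k)` (`sum_pow_card_walkLabels_le`). The choice `c = 2 k / n`, which
satisfies `r ≤ s` when `2 k r ≤ n`, yields `E tr W ^ (2 k) ≤ n (8 k n r) ^ k`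
(`integral_trace_edgeMatrix_pow_le`).

By Markov's inequality, `‖W‖ ≥ η n` has probability at most `d n (8 k r / (η² n)) ^ k`. For
`k = ⌈log n⌉` the base of this power tends to `0` as soon as `log n / n = o(p q)`, hence under the
hypothesis with `c₀ = 2`; so the probabilities are summable, and the Borel–Cantelli lemma
concludes, whatever the joint law for different `n`.
-/

noncomputable section

namespace GroupSync

/-! ### Walks and their distinct edges -/

section Walks

variable {V ι : Type*}

theorem sum_walk_succ [Fintype V] {M : Type*} [AddCommMonoid M] (L : ℕ)
    (F : (Fin (L + 1) → V) → M) :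
    ∑ w, F w = ∑ w : Fin L → V, ∑ v, F (Fin.snoc w v) := by
  rw [← (Fin.snocEquiv fun _ : Fin (L + 1) => V).sum_comp, Fintype.sum_prod_type,
    Finset.sum_comm]
  rfl

/-- The entries of a matrix power as sums over walks. -/
theorem pow_apply_eq_sum_walk [Fintype V] [DecidableEq V] {R : Type*} [CommSemiring R]
    (W : Matrix V V R) (L : ℕ) (i j : V) :
    (W ^ L) i j = ∑ w : Fin (L + 1) → V, if w 0 = i ∧ w (Fin.last L) = j then
      ∏ t : Fin L, W (w t.castSucc) (w t.succ) else 0 := by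
  induction L generalizing j with
  | zero =>
    rw [sum_walk_succ, Fintype.sum_unique, pow_zero, Matrix.one_apply]
    have (v : V) : (Fin.snoc (default : Fin 0 → V) v : Fin 1 → V) 0 = v :=
      Fin.snoc_last (α := fun _ : Fin 1 => V) v _
    simp [this, ite_and, eq_comm]
  | succ L ih =>
    rw [pow_succ, Matrix.mul_apply, sum_walk_succ]
    have h0 (w : Fin (L + 1) → V) (v : V) :
        (Fin.snoc w v : Fin (L + 2) → V) 0 = w 0 :=
      Fin.snoc_castSucc (α := fun _ : Fin (L + 2) => V) v w 0
    have h1 (w : Fin (L + 1) → V) (v : V) :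
        (Fin.snoc w v : Fin (L + 2) → V) (Fin.last (L + 1)) = v :=
      Fin.snoc_last (α := fun _ : Fin (L + 2) => V) v w
    have h2 (w : Fin (L + 1) → V) (v : V) (t : Fin (L + 1)) :
        (Fin.snoc w v : Fin (L + 2) → V) t.castSucc = w t :=
      Fin.snoc_castSucc (α := fun _ : Fin (L + 2) => V) v w t
    simp only [ih, Finset.sum_mul, h0, h1, Fin.prod_univ_castSucc, h2,
      ← Fin.castSucc_succ, Fin.succ_last]
    rw [Finset.sum_comm]
    refine Finset.sum_congr rfl fun w _ => ?_
    simp only [ite_and, ite_mul, zero_mul]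
    split_ifs <;> simp

variable [DecidableEq ι]

/-- The set of distinct labels seen along a walk, where `key u v` labels the step from `u`
to `v`. -/
def walkLabels (key : V → V → ι) {L : ℕ} (w : Fin (L + 1) → V) : Finset ι :=
  Finset.univ.image fun t : Fin L => key (w t.castSucc) (w t.succ)

theorem walkLabels_snoc (key : V → V → ι) {L : ℕ} (w : Fin (L + 1) → V) (v : V) :
    walkLabels key (Fin.snoc w v : Fin (L + 2) → V)
      = insert (key (w (Fin.last L)) v) (walkLabels key w) := by
  have h1 : (Fin.snoc w v : Fin (L + 2) → V) (Fin.last (L + 1)) = v :=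
    Fin.snoc_last (α := fun _ : Fin (L + 2) => V) v w
  have h2 (t : Fin (L + 1)) : (Fin.snoc w v : Fin (L + 2) → V) t.castSucc = w t :=
    Fin.snoc_castSucc (α := fun _ : Fin (L + 2) => V) v w t
  ext i
  simp only [walkLabels, Finset.mem_image, Finset.mem_univ, true_and, Finset.mem_insert]
  rw [Fin.exists_fin_succ']
  simp only [h2, Fin.succ_last, h1, ← Fin.castSucc_succ]
  tauto

theorem card_walkLabels_le (key : V → V → ι) {L : ℕ} (w : Fin (L + 1) → V) :
    (walkLabels key w).card ≤ L :=
  Finset.card_image_le.trans_eq (by simp)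

/-- Weighted count of the walks with `L` steps, each distinct label costing a factor `c`. A step
either has a new label, with `card V` choices and weight `c`, or repeats one of at most `K` earlier
labels, which determines its endpoint. -/
theorem sum_pow_card_walkLabels_le [Fintype V] (key : V → V → ι)
    (hkey : ∀ u, Function.Injective (key u)) {c : ℝ} (hc : 0 ≤ c) (K L : ℕ) (hL : L ≤ K) :
    ∑ w : Fin (L + 1) → V, c ^ (walkLabels key w).card
      ≤ Fintype.card V * (c * Fintype.card V + K) ^ L := by
  induction L with
  | zero => simp [walkLabels]
  | succ L ih =>
    rw [sum_walk_succ]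
    have step (w : Fin (L + 1) → V) :
        ∑ v, c ^ (walkLabels key (Fin.snoc w v : Fin (L + 2) → V)).card
          ≤ c ^ (walkLabels key w).card * (c * Fintype.card V + K) := by
      have hv (v : V) : c ^ (walkLabels key (Fin.snoc w v : Fin (L + 2) → V)).card
          ≤ c ^ (walkLabels key w).card
            * (c + if key (w (Fin.last L)) v ∈ walkLabels key w then 1 else 0) := by
        rw [walkLabels_snoc]
        split_ifs with h
        · rw [Finset.insert_eq_of_mem h]
          nlinarith [pow_nonneg hc (walkLabels key w).card]
        · rw [Finset.card_insert_of_notMem h, pow_succ, add_zero]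
      have hcount : (Finset.univ.filter
          fun v => key (w (Fin.last L)) v ∈ walkLabels key w).card ≤ K :=
        (Finset.card_le_card_of_injOn (key (w (Fin.last L))) (by simp [Set.MapsTo])
          ((hkey _).injOn)).trans ((card_walkLabels_le key w).trans (by omega))
      refine (Finset.sum_le_sum fun v _ => hv v).trans ?_
      rw [← Finset.mul_sum, Finset.sum_add_distrib, Finset.sum_boole]
      gcongr
      simp [mul_comm]
    refine (Finset.sum_le_sum fun w _ => step w).trans ?_
    rw [← Finset.sum_mul, pow_succ, ← mul_assoc]
    gcongr
    exact ih (by omega)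

end Walks

/-! ### Moments of a random matrix with factoring entries -/

section Moments

variable {V ι Ω : Type*} [Fintype V] [DecidableEq V] [Fintype ι] [DecidableEq ι]
  [MeasurableSpace Ω] {μ : Measure Ω}

/-- The method of moments for a random matrix `(y (key u v))`: if the mixed moments of the labels
factor up to the bound `s ^ m * c` on each `m`-th moment, `m ≥ 1`, then only the number of distinct
labels of a walk matters. -/
theorem integral_trace_pow_le (key : V → V → ι) (hkey : ∀ u, Function.Injective (key u))
    (y : ι → Ω → ℝ) (s c : ℝ) (hs : 0 ≤ s) (hc : 0 ≤ c)
    (hint : ∀ m : ι → ℕ, Integrable (fun ω => ∏ i, y i ω ^ m i) μ)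
    (hmom : ∀ m : ι → ℕ, ∫ ω, ∏ i, y i ω ^ m i ∂μ ≤ ∏ i, if m i = 0 then 1 else s ^ m i * c)
    (L : ℕ) :
    ∫ ω, ((Matrix.of fun u v => y (key u v) ω) ^ L).trace ∂μ
      ≤ s ^ L * (Fintype.card V * (c * Fintype.card V + L) ^ L) := by
  set m : (Fin (L + 1) → V) → ι → ℕ := fun w i =>
    (Finset.univ.filter fun t : Fin L => key (w t.castSucc) (w t.succ) = i).card with hm
  have hprod (w : Fin (L + 1) → V) (ω : Ω) :
      ∏ t : Fin L, y (key (w t.castSucc) (w t.succ)) ω = ∏ i, y i ω ^ m w i := by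
    rw [← Finset.prod_fiberwise_of_maps_to (s := Finset.univ) (t := Finset.univ)
      (g := fun t : Fin L => key (w t.castSucc) (w t.succ)) (by simp)]
    refine Finset.prod_congr rfl fun i _ => ?_
    rw [hm, ← Finset.prod_const]
    refine Finset.prod_congr rfl fun t ht => ?_
    rw [(Finset.mem_filter.1 ht).2]
  have htrace (ω : Ω) : ((Matrix.of fun u v => y (key u v) ω) ^ L).trace
      = ∑ w : Fin (L + 1) → V, if w (Fin.last L) = w 0 then ∏ i, y i ω ^ m w i else 0 := by
    simp only [Matrix.trace, Matrix.diag_apply, pow_apply_eq_sum_walk, Matrix.of_apply, hprod]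
    rw [Finset.sum_comm]
    refine Finset.sum_congr rfl fun w _ => ?_
    simp [ite_and]
  have hbound (w : Fin (L + 1) → V) :
      ∏ i, (if m w i = 0 then 1 else s ^ m w i * c) = s ^ L * c ^ (walkLabels key w).card := by
    have h1 (i : ι) : (if m w i = 0 then 1 else s ^ m w i * c)
        = s ^ m w i * if i ∈ walkLabels key w then c else 1 := by
      have : i ∈ walkLabels key w ↔ m w i ≠ 0 := by
        simp [hm, walkLabels, Finset.filter_eq_empty_iff]
      by_cases h : m w i = 0 <;> simp [this, h]
    have h2 : ∑ i, m w i = L := by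
      rw [hm, ← Finset.card_eq_sum_card_fiberwise (by simp [Set.MapsTo])]
      simp
    simp_rw [h1]
    rw [Finset.prod_mul_distrib, Finset.prod_pow_eq_pow_sum, h2, Finset.prod_ite_mem]
    simp
  simp_rw [htrace]
  rw [integral_finsetSum]
  · refine le_trans (Finset.sum_le_sum (g := fun w => s ^ L * c ^ (walkLabels key w).card)
      fun w _ => ?_) ?_
    · split_ifs
      · exact (hmom _).trans_eq (hbound w)
      · simp only [integral_zero]
        positivity
    · rw [← Finset.mul_sum]
      gcongr
      exact sum_pow_card_walkLabels_le key hkey hc L L le_rfl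
  · intro w _
    split_ifs
    · exact hint _
    · simp

end Moments

/-! ### Operator norms and traces -/

section Norms

/-- Deduced from the equality for exponents `2 ^ j`, by splitting off the exponent `2 ^ k - k`. -/
theorem _root_.IsSelfAdjoint.pow_norm_le_norm_pow {A : Type*} [NormedRing A] [StarRing A]
    [CStarRing A] {a : A} (ha : IsSelfAdjoint a) (k : ℕ) (hk : k ≠ 0) : ‖a‖ ^ k ≤ ‖a ^ k‖ := by
  rcases eq_or_ne (‖a‖) 0 with h0 | h0
  · rw [h0, zero_pow hk]
    positivity
  have hpos : 0 < ‖a‖ := lt_of_le_of_ne (norm_nonneg a) h0.symm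
  have hlt : k < 2 ^ k := Nat.lt_two_pow_self
  have h2 := ha.norm_pow_two_pow k
  have h3 : ‖a ^ (2 ^ k)‖ ≤ ‖a ^ k‖ * ‖a‖ ^ (2 ^ k - k) := by
    calc ‖a ^ (2 ^ k)‖ = ‖a ^ k * a ^ (2 ^ k - k)‖ := by
          rw [← pow_add, Nat.add_sub_cancel' hlt.le]
      _ ≤ ‖a ^ k‖ * ‖a ^ (2 ^ k - k)‖ := norm_mul_le _ _
      _ ≤ _ := by
          gcongr
          exact norm_pow_le' a (Nat.sub_pos_of_lt hlt)
  rw [h2, ← Nat.add_sub_cancel' hlt.le, pow_add] at h3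
  simp only [Nat.add_sub_cancel_left] at h3
  exact le_of_mul_le_mul_right h3 (by positivity)

/-- The operator norm is at most the Hilbert–Schmidt norm. -/
theorem norm_toEuclideanCLM_sq_le {m : Type*} [Fintype m] [DecidableEq m] (A : Matrix m m ℂ) :
    ‖Matrix.toEuclideanCLM (𝕜 := ℂ) (n := m) A‖ ^ 2 ≤ (A * Aᴴ).trace.re := by
  have htr : (A * Aᴴ).trace.re = ∑ i, ∑ j, ‖A i j‖ ^ 2 := by
    simp [Matrix.trace, Matrix.mul_apply, Complex.mul_conj, Complex.normSq_eq_norm_sq]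
    norm_cast
  rw [htr]
  refine (Real.le_sqrt (norm_nonneg _) (by positivity)).1 ?_
  refine ContinuousLinearMap.opNorm_le_bound _ (Real.sqrt_nonneg _) fun x => ?_
  rw [EuclideanSpace.norm_eq, EuclideanSpace.norm_eq, ← Real.sqrt_mul (by positivity)]
  refine Real.sqrt_le_sqrt ?_
  rw [Finset.sum_mul]
  refine Finset.sum_le_sum fun i _ => ?_
  have h1 : ‖(Matrix.toEuclideanCLM (𝕜 := ℂ) (n := m) A x) i‖ ≤ ∑ j, ‖A i j‖ * ‖x j‖ := by
    rw [Matrix.ofLp_toEuclideanCLM, Matrix.mulVec, dotProduct]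
    exact (norm_sum_le _ _).trans_eq (by simp)
  exact (pow_le_pow_left₀ (norm_nonneg _) h1 2).trans
    (Finset.sum_mul_sq_le_sq_mul_sq _ _ _)

variable {n d : ℕ}

theorem opNorm_nonneg (A : BlockMatrix n d) : 0 ≤ opNorm A := norm_nonneg _

theorem opNorm_add_le (A B : BlockMatrix n d) : opNorm (A + B) ≤ opNorm A + opNorm B := by
  simp only [opNorm, map_add]
  exact norm_add_le _ _

theorem opNorm_smul (c : ℂ) (A : BlockMatrix n d) : opNorm (c • A) = ‖c‖ * opNorm A := by
  simp only [opNorm, map_smul, norm_smul]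

theorem opNorm_one_le : opNorm (1 : BlockMatrix n d) ≤ 1 := by
  simp only [opNorm, map_one]
  exact ContinuousLinearMap.norm_id_le

/-- `‖A‖ ^ k ≤ ‖A ^ k‖`, and the right side is at most the Hilbert–Schmidt norm of `A ^ k`,
whose square is `tr (A ^ (2 * k))`. -/
theorem opNorm_pow_le_trace {A : BlockMatrix n d} (hA : A.IsHermitian) {k : ℕ} (hk : k ≠ 0) :
    opNorm A ^ (2 * k) ≤ (A ^ (2 * k)).trace.re := by
  have hsa : IsSelfAdjoint (Matrix.toEuclideanCLM (𝕜 := ℂ) (n := Fin n × Fin d) A) :=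
    IsSelfAdjoint.map (show IsSelfAdjoint A from hA) _
  have h1 := IsSelfAdjoint.pow_norm_le_norm_pow
    (A := EuclideanSpace ℂ (Fin n × Fin d) →L[ℂ] EuclideanSpace ℂ (Fin n × Fin d)) hsa k hk
  have h2 := norm_toEuclideanCLM_sq_le (A ^ k)
  rw [(hA.pow k).eq, ← pow_add, ← two_mul, map_pow] at h2
  rw [mul_comm, pow_mul, mul_comm]
  exact (pow_le_pow_left₀ (by positivity) h1 2).trans h2

/-- The block matrix with blocks `A i j • (U i * (U j)ᴴ)`: the Kronecker product of `A` with the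
identity, conjugated by the block diagonal unitary with blocks `U i`. -/
def blockTwist (U : Fin n → Matrix.unitaryGroup (Fin d) ℂ) (A : Matrix (Fin n) (Fin n) ℝ) :
    BlockMatrix n d :=
  Matrix.of fun x y => (A x.1 y.1 : ℂ)
    * ((U x.1 : Matrix (Fin d) (Fin d) ℂ) * (U y.1 : Matrix (Fin d) (Fin d) ℂ)ᴴ) x.2 y.2

variable (U : Fin n → Matrix.unitaryGroup (Fin d) ℂ)

theorem coe_unitary_mul_conjTranspose (u : Matrix.unitaryGroup (Fin d) ℂ) :
    (u : Matrix (Fin d) (Fin d) ℂ) * (u : Matrix (Fin d) (Fin d) ℂ)ᴴ = 1 :=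
  Matrix.mem_unitaryGroup_iff.1 u.2

theorem coe_unitary_conjTranspose_mul (u : Matrix.unitaryGroup (Fin d) ℂ) :
    (u : Matrix (Fin d) (Fin d) ℂ)ᴴ * (u : Matrix (Fin d) (Fin d) ℂ) = 1 :=
  Matrix.mem_unitaryGroup_iff'.1 u.2

theorem blockTwist_one : blockTwist U 1 = 1 := by
  ext ⟨i, a⟩ ⟨j, b⟩
  by_cases h : i = j
  · subst h
    simp [blockTwist, coe_unitary_mul_conjTranspose, Matrix.one_apply]
  · simp [blockTwist, Matrix.one_apply, h]

theorem blockTwist_mul (A B : Matrix (Fin n) (Fin n) ℝ) :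
    blockTwist U (A * B) = blockTwist U A * blockTwist U B := by
  ext ⟨i, a⟩ ⟨j, b⟩
  have h (k : Fin n) : ((U i : Matrix (Fin d) (Fin d) ℂ) * (U j : Matrix (Fin d) (Fin d) ℂ)ᴴ) a b
      = ∑ c, ((U i : Matrix (Fin d) (Fin d) ℂ) * (U k : Matrix (Fin d) (Fin d) ℂ)ᴴ) a c
        * ((U k : Matrix (Fin d) (Fin d) ℂ) * (U j : Matrix (Fin d) (Fin d) ℂ)ᴴ) c b := by
    rw [← Matrix.mul_apply, Matrix.mul_assoc,
      ← Matrix.mul_assoc (U k : Matrix (Fin d) (Fin d) ℂ)ᴴ, coe_unitary_conjTranspose_mul,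
      Matrix.one_mul]
  simp only [blockTwist, Matrix.of_apply, Matrix.mul_apply (M := A), Matrix.mul_apply
    (M := Matrix.of _), Fintype.sum_prod_type, Complex.ofReal_sum, Complex.ofReal_mul,
    Finset.sum_mul]
  refine Finset.sum_congr rfl fun k _ => ?_
  rw [h k, Finset.mul_sum]
  refine Finset.sum_congr rfl fun c _ => ?_
  ring

theorem blockTwist_pow (A : Matrix (Fin n) (Fin n) ℝ) (k : ℕ) :
    blockTwist U (A ^ k) = blockTwist U A ^ k := by
  induction k with
  | zero => simp [blockTwist_one]
  | succ k ih => rw [pow_succ, pow_succ, blockTwist_mul, ih]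

theorem trace_blockTwist (A : Matrix (Fin n) (Fin n) ℝ) :
    (blockTwist U A).trace = ((d * A.trace : ℝ) : ℂ) := by
  have h (i : Fin n) : ∑ a, ((U i : Matrix (Fin d) (Fin d) ℂ)
      * (U i : Matrix (Fin d) (Fin d) ℂ)ᴴ) a a = d := by
    simp [coe_unitary_mul_conjTranspose]
  simp only [Matrix.trace, Matrix.diag_apply, blockTwist, Matrix.of_apply,
    Fintype.sum_prod_type, ← Finset.mul_sum, h]
  push_cast
  rw [Finset.mul_sum]
  exact Finset.sum_congr rfl fun i _ => mul_comm _ _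

theorem isHermitian_blockTwist {A : Matrix (Fin n) (Fin n) ℝ} (hA : A.IsSymm) :
    (blockTwist U A).IsHermitian := by
  ext ⟨i, a⟩ ⟨j, b⟩
  have h : star (((U j : Matrix (Fin d) (Fin d) ℂ) * (U i : Matrix (Fin d) (Fin d) ℂ)ᴴ) b a)
      = ((U i : Matrix (Fin d) (Fin d) ℂ) * (U j : Matrix (Fin d) (Fin d) ℂ)ᴴ) a b := by
    rw [← Matrix.conjTranspose_apply, Matrix.conjTranspose_mul, Matrix.conjTranspose_conjTranspose]
  simp only [Matrix.conjTranspose_apply, blockTwist, Matrix.of_apply, star_mul', h]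
  simp [hA.apply i j]

/-- Up to the dimension factor, the moments of the twisted matrix are those of `A`: the group
elements play no role. -/
theorem opNorm_blockTwist_pow_le {A : Matrix (Fin n) (Fin n) ℝ} (hA : A.IsSymm) {k : ℕ}
    (hk : k ≠ 0) : opNorm (blockTwist U A) ^ (2 * k) ≤ d * (A ^ (2 * k)).trace := by
  have h := opNorm_pow_le_trace (isHermitian_blockTwist U hA) hk
  rwa [← blockTwist_pow, trace_blockTwist, Complex.ofReal_re] at h

end Norms

/-! ### The difference `Y₁ - Y₂` -/

section Residual

variable {n : ℕ}

/-- The edge joining two vertices, `none` if they are equal. -/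
def edgeLabel (u v : Fin n) : Option (Edge n) :=
  if h : u < v then some ⟨(u, v), h⟩ else if h : v < u then some ⟨(v, u), h⟩ else none

theorem edgeLabel_comm (u v : Fin n) : edgeLabel u v = edgeLabel v u := by
  unfold edgeLabel
  split_ifs <;> first | rfl | (exfalso; omega)

theorem edgeLabel_injective (u : Fin n) : Function.Injective (edgeLabel u) := by
  intro v w h
  unfold edgeLabel at h
  split_ifs at h <;> simp at h <;> omega

/-- The symmetric matrix with the entries `x` on the edges and zero diagonal. -/
def edgeMatrix (x : Edge n → ℝ) : Matrix (Fin n) (Fin n) ℝ :=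
  Matrix.of fun u v => (edgeLabel u v).elim 0 x

theorem isSymm_edgeMatrix (x : Edge n → ℝ) : (edgeMatrix x).IsSymm := by
  ext u v
  simp [edgeMatrix, edgeLabel_comm u v]

/-- The normalized, centred indicator that an edge is both available and uncorrupted, where
`r` is the inverse of the probability of this event. -/
def centredWeight (r : ℝ) (b : Bool × Bool) : ℝ := (if b.1 && b.2 then r else 0) - 1

/-- The noise parts cancel in `Y₁ - Y₂`, and the rest is a twisted scalar matrix. -/
theorem Y₁_sub_Y₂ {G : Type*} [Group G] {d : ℕ} (π : G →* Matrix.unitaryGroup (Fin d) ℂ)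
    (p q : unitInterval) (σ : ℝ) (g : Fin n → G) (e δ : Edge n → Bool) (h : Edge n → G)
    (ε : Edge n → Fin d → Fin d → ℂ) :
    Y₁ π p q σ g e δ h ε - Y₂ π p q σ g e δ h ε
      = ((1 / n : ℝ) : ℂ) • (blockTwist (fun i => π (g i))
          (edgeMatrix fun a => centredWeight (1 / (p * q)) (e a, δ a))
        + ((1 / (p * q) - 1 : ℝ) : ℂ) • 1) := by
  have key : Y₁ π p q σ g e δ h ε - Y₂ π p q σ g e δ h ε
      = ((1 / ((n : ℝ) * (q : ℝ) * (p : ℝ)) : ℝ) : ℂ) •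
          (mask d e ⊙ mask d δ ⊙ (signal π g * (signal π g)ᴴ))
        - ((1 / (n : ℝ) : ℝ) : ℂ) • (signal π g * (signal π g)ᴴ) := by
    rw [Y₁, Y₂, measurement, smul_add]
    abel
  have hr : 1 / ((n : ℝ) * (q : ℝ) * (p : ℝ)) = 1 / n * (1 / (p * q)) := by
    rw [mul_assoc, mul_comm (q : ℝ), one_div_mul_one_div]
  have hX : signal π g * (signal π g)ᴴ
      = Matrix.of fun x y => ((π (g x.1) : Matrix (Fin d) (Fin d) ℂ)
        * (π (g y.1) : Matrix (Fin d) (Fin d) ℂ)ᴴ) x.2 y.2 := by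
    ext x y
    simp [signal, Matrix.mul_apply]
  rw [key, hr, hX]
  ext ⟨i, a⟩ ⟨j, b⟩
  rcases lt_trichotomy i j with hij | hij | hij
  · have hne : ((i, a) : Fin n × Fin d) ≠ (j, b) := fun h => hij.ne (congrArg Prod.fst h)
    simp only [mask, hermBlock, blockTwist, edgeMatrix, edgeLabel, centredWeight, onesBlock,
      Matrix.sub_apply, Matrix.add_apply, Matrix.smul_apply, Matrix.hadamard_apply,
      Matrix.of_apply, dif_pos hij, Option.elim_some, Matrix.one_apply_ne hne, smul_eq_mul]
    cases e ⟨(i, j), hij⟩ <;> cases δ ⟨(i, j), hij⟩ <;> (simp; try ring)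
  · subst hij
    simp only [mask, hermBlock, blockTwist, edgeMatrix, edgeLabel, onesBlock,
      Matrix.sub_apply, Matrix.add_apply, Matrix.smul_apply, Matrix.hadamard_apply,
      Matrix.of_apply, lt_irrefl, dite_false, Option.elim_none, smul_eq_mul,
      coe_unitary_mul_conjTranspose]
    by_cases hab : a = b
    · subst hab
      simp
      ring
    · have hne : ((i, a) : Fin n × Fin d) ≠ (i, b) := fun h => hab (congrArg Prod.snd h)
      simp [Matrix.one_apply_ne hne, Matrix.one_apply_ne hab]
  · have hne : ((i, a) : Fin n × Fin d) ≠ (j, b) := fun h => hij.ne' (congrArg Prod.fst h)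
    simp only [mask, hermBlock, blockTwist, edgeMatrix, edgeLabel, centredWeight, onesBlock,
      Matrix.sub_apply, Matrix.add_apply, Matrix.smul_apply, Matrix.hadamard_apply,
      Matrix.of_apply, dif_pos hij, dif_neg hij.not_gt, Option.elim_some,
      Matrix.one_apply_ne hne, smul_eq_mul, Matrix.conjTranspose_apply]
    cases e ⟨(j, i), hij⟩ <;> cases δ ⟨(j, i), hij⟩ <;> (simp; try ring)

end Residual

/-! ### Moments of the edge indicators -/

section Law

variable {n : ℕ}

/-- The law of the pairs (available, uncorrupted), independent over the edges. -/
def edgeLaw (n : ℕ) (p q : unitInterval) : Measure (Edge n → Bool × Bool) :=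
  Measure.pi fun _ => (bernoulliMeasure true false q).prod (bernoulliMeasure true false p)

instance (p q : unitInterval) : IsProbabilityMeasure (edgeLaw n p q) := by
  unfold edgeLaw; infer_instance

instance : IsProbabilityMeasure realGaussian :=
  Measure.isProbabilityMeasure_map (by fun_prop)

instance : IsProbabilityMeasure complexGaussian :=
  Measure.isProbabilityMeasure_map (by fun_prop)

theorem hasLaw_edgeLaw {G : Type*} [Group G] [TopologicalSpace G] [IsTopologicalGroup G]
    [CompactSpace G] [MeasurableSpace G] [BorelSpace G] {d : ℕ} {p q : unitInterval}
    {γ : Measure ℂ} [IsProbabilityMeasure γ] {Ω : Type*} [MeasurableSpace Ω] {P : Measure Ω}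
    {e δ : Ω → Edge n → Bool} {h : Ω → Edge n → G} {ε : Ω → Edge n → Fin d → Fin d → ℂ}
    (hlaw : HasLaw (fun ω => (e ω, δ ω, h ω, ε ω)) (corruptionLaw n d G p q γ) P) :
    HasLaw (fun ω a => (e ω a, δ ω a)) (edgeLaw n p q) P := by
  have : IsProbabilityMeasure
      (Measure.haarMeasure (⊤ : TopologicalSpace.PositiveCompacts G)) :=
    ⟨by simpa using Measure.haarMeasure_self (K₀ := (⊤ : TopologicalSpace.PositiveCompacts G))⟩
  have h1 := (MeasurePreserving.prod (MeasurePreserving.id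
    (Measure.pi fun _ : Edge n => bernoulliMeasure true false q))
    (measurePreserving_fst (μ := Measure.pi fun _ : Edge n => bernoulliMeasure true false p)
      (ν := (Measure.pi fun _ : Edge n =>
          Measure.haarMeasure (⊤ : TopologicalSpace.PositiveCompacts G)).prod
        (Measure.pi fun _ : Edge n => Measure.pi fun _ : Fin d =>
          Measure.pi fun _ : Fin d => γ)))).comp_hasLaw hlaw
  exact ((measurePreserving_arrowProdEquivProdArrow Bool Bool (Edge n)
    (fun _ => bernoulliMeasure true false q)
    (fun _ => bernoulliMeasure true false p)).symm _).comp_hasLaw h1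

theorem integral_centredWeight_pow (p q : unitInterval) (r : ℝ) (m : ℕ) :
    ∫ b, centredWeight r b ^ m
      ∂((bernoulliMeasure true false q).prod (bernoulliMeasure true false p))
      = p * q * (r - 1) ^ m + (1 - p * q) * (-1) ^ m := by
  rw [integral_prod _ Integrable.of_finite]
  simp only [integral_bernoulliMeasure, centredWeight, smul_eq_mul]
  simp
  ring

/-- The first moment vanishes, and the `m`-th one is at most `r ^ (m - 1)` for `m ≥ 2`. With
`s ^ 2 * c = r` and `r ≤ s`, this is at most `s ^ (m - 2) * r = s ^ m * c`. -/
theorem abs_integral_centredWeight_pow_le (p q : unitInterval) {r s c : ℝ} (hr : p * q * r = 1)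
    (hrs : r ≤ s) (hsc : s ^ 2 * c = r) (m : ℕ) :
    |∫ b, centredWeight r b ^ m
      ∂((bernoulliMeasure true false q).prod (bernoulliMeasure true false p))|
      ≤ if m = 0 then 1 else s ^ m * c := by
  have hρ0 : (0 : ℝ) ≤ p * q := mul_nonneg p.2.1 q.2.1
  have hρ1 : (p * q : ℝ) ≤ 1 := mul_le_one₀ p.2.2 q.2.1 q.2.2
  have hr1 : 1 ≤ r := by
    by_contra! hlt
    have : (p * q : ℝ) = 1 := le_antisymm hρ1 (by nlinarith)
    rw [this] at hr
    linarith
  have hs1 : 1 ≤ s := hr1.trans hrs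
  have hc : 0 < c := by
    by_contra! hle
    nlinarith [sq_nonneg s]
  rw [integral_centredWeight_pow]
  obtain rfl | rfl | ⟨m, rfl⟩ : m = 0 ∨ m = 1 ∨ ∃ l, m = l + 2 := by
    rcases m with _ | _ | l
    · simp
    · simp
    · exact .inr (.inr ⟨l, rfl⟩)
  · simp
  · have : (p * q * (r - 1) ^ 1 + (1 - p * q) * (-1) ^ 1 : ℝ) = 0 := by linear_combination hr
    rw [this]
    simp only [one_ne_zero, if_false, abs_zero]
    positivity
  · rw [if_neg (by omega)]
    have h5 : 0 ≤ (1 - p * q : ℝ) := by linarith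
    have hr2 : 0 ≤ r - 1 := by linarith
    have h4 : (p * q * (r - 1) ^ (m + 2) + (1 - p * q) * (-1) ^ (m + 2) : ℝ)
        = (1 - p * q) * ((r - 1) ^ (m + 1) + (-1) ^ (m + 2)) := by
      linear_combination (r - 1) ^ (m + 1) * hr
    have h6 : (r - 1) ^ (m + 1) + 1 ≤ r ^ (m + 1) := by
      have h1 : (r - 1) ^ m ≤ r ^ m := pow_le_pow_left₀ hr2 (by linarith) m
      have h2 : 1 ≤ r ^ m := one_le_pow₀ hr1
      calc (r - 1) ^ (m + 1) + 1 ≤ r ^ m * (r - 1) + r ^ m := by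
            rw [pow_succ]
            gcongr
        _ = r ^ (m + 1) := by ring
    rw [h4, abs_mul, abs_of_nonneg h5]
    calc (1 - p * q : ℝ) * |(r - 1) ^ (m + 1) + (-1) ^ (m + 2)|
        ≤ 1 * r ^ (m + 1) := by
          refine mul_le_mul (by linarith) ((abs_add_le _ _).trans ?_) (abs_nonneg _) zero_le_one
          rwa [abs_of_nonneg (pow_nonneg hr2 _), abs_neg_one_pow]
      _ = r ^ m * r := by ring
      _ ≤ s ^ m * r := by gcongr
      _ = s ^ (m + 2) * c := by rw [← hsc]; ring

/-- Moment bound for the centred weights. The absent loops are the label `none`, carrying the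
value `0`. -/
theorem integral_trace_edgeMatrix_pow_le (p q : unitInterval) {r : ℝ} (hr : p * q * r = 1) {k : ℕ}
    (hk : k ≠ 0) (hn : 2 * k * r ≤ n) :
    ∫ b, (edgeMatrix (fun a : Edge n => centredWeight r (b a)) ^ (2 * k)).trace ∂edgeLaw n p q
      ≤ n * (8 * k * n * r) ^ k := by
  have hρ0 : (0 : ℝ) ≤ p * q := mul_nonneg p.2.1 q.2.1
  have hr0 : 0 < r := by
    by_contra! hle
    nlinarith
  have hk0 : (0 : ℝ) < k := by positivity
  have hn0 : (0 : ℝ) < n := lt_of_lt_of_le (by positivity) hn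
  -- this `c` balances new and repeated edges: `c * n = 2 * k`
  set c : ℝ := 2 * k / n with hc
  set s : ℝ := √(n * r / (2 * k)) with hs
  have hs2 : s ^ 2 = n * r / (2 * k) := Real.sq_sqrt (by positivity)
  have hsc : s ^ 2 * c = r := by rw [hs2, hc]; field_simp
  have hrs : r ≤ s := by
    refine Real.le_sqrt_of_sq_le ?_
    rw [le_div_iff₀ (by positivity)]
    nlinarith
  set y : Option (Edge n) → (Edge n → Bool × Bool) → ℝ :=
    fun o b => o.elim 0 fun a => centredWeight r (b a) with hy
  have hmom (m : Option (Edge n) → ℕ) : ∫ b, ∏ i, y i b ^ m i ∂edgeLaw n p q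
      ≤ ∏ i, if m i = 0 then 1 else s ^ m i * c := by
    have hc0 : 0 ≤ c := by positivity
    have hs0 : 0 ≤ s := Real.sqrt_nonneg _
    simp only [Fintype.prod_option, hy, Option.elim_none, Option.elim_some]
    rw [integral_const_mul, edgeLaw,
      integral_fintype_prod_eq_prod (fun a b => centredWeight r b ^ m (some a))]
    by_cases h0 : m none = 0
    · simp only [h0, pow_zero, one_mul, if_true]
      refine (le_abs_self _).trans ?_
      rw [Finset.abs_prod]
      exact Finset.prod_le_prod (fun a _ => abs_nonneg _)
        fun a _ => abs_integral_centredWeight_pow_le p q hr hrs hsc _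
    · rw [zero_pow h0, zero_mul, if_neg h0]
      refine mul_nonneg (by positivity) (Finset.prod_nonneg fun a _ => ?_)
      split_ifs <;> positivity
  have h := integral_trace_pow_le edgeLabel edgeLabel_injective y s c (Real.sqrt_nonneg _)
    (by positivity) (μ := edgeLaw n p q) (fun m => Integrable.of_finite) hmom (2 * k)
  refine h.trans_eq ?_
  have h1 : c * n + (2 * k : ℕ) = 4 * k := by
    rw [hc]; push_cast; field_simp; norm_num
  rw [Fintype.card_fin, h1, pow_mul, pow_mul, hs2, mul_left_comm, ← mul_pow]
  congr 2
  field_simp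
  ring

end Law

/-! ### Tail bounds and almost sure convergence -/

section Tail

/-- Markov's inequality for the `2 k`-th moment. The unitaries may depend on the outcome in any
way, measurably or not, since the trace bound does not see them. -/
theorem measureReal_opNorm_ge_le {n d : ℕ} {p q : unitInterval} {Ω : Type*} [MeasurableSpace Ω]
    {P : Measure Ω} [IsProbabilityMeasure P] {b : Ω → Edge n → Bool × Bool}
    (hb : HasLaw b (edgeLaw n p q) P) (U : Ω → Fin n → Matrix.unitaryGroup (Fin d) ℂ)
    {r : ℝ} (hr : p * q * r = 1) {k : ℕ} (hk : k ≠ 0) (hn0 : 0 < n) (hn : 2 * k * r ≤ n)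
    {η : ℝ} (hη : 0 < η) :
    P.real {ω | η * n ≤ opNorm (blockTwist (U ω)
        (edgeMatrix fun a => centredWeight r (b ω a)))}
      ≤ d * (n * (8 * k * r / (η ^ 2 * n)) ^ k) := by
  set W : (Edge n → Bool × Bool) → Matrix (Fin n) (Fin n) ℝ :=
    fun x => edgeMatrix fun a => centredWeight r (x a) with hW
  set T : (Edge n → Bool × Bool) → ℝ := fun x => d * (W x ^ (2 * k)).trace with hT
  have hn' : (0 : ℝ) < n := by exact_mod_cast hn0
  have hpos : 0 < (η * n) ^ (2 * k) := by positivity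
  have hTnonneg (x) : 0 ≤ T x :=
    (pow_nonneg (opNorm_nonneg (blockTwist (d := d) 1 (W x))) (2 * k)).trans
      (opNorm_blockTwist_pow_le 1 (isSymm_edgeMatrix _) hk)
  have hsub : {ω | η * n ≤ opNorm (blockTwist (U ω) (W (b ω)))}
      ⊆ {ω | (η * n) ^ (2 * k) ≤ T (b ω)} := fun ω hω =>
    (pow_le_pow_left₀ (by positivity) hω _).trans
      (opNorm_blockTwist_pow_le (U ω) (isSymm_edgeMatrix _) hk)
  have hmarkov := mul_meas_ge_le_integral_of_nonneg (μ := edgeLaw n p q)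
    (ae_of_all _ hTnonneg) Integrable.of_finite ((η * n) ^ (2 * k))
  have hint : ∫ x, T x ∂edgeLaw n p q ≤ d * (n * (8 * k * n * r) ^ k) := by
    simp only [hT]
    rw [integral_const_mul]
    gcongr
    exact integral_trace_edgeMatrix_pow_le p q hr hk hn
  calc P.real {ω | η * n ≤ opNorm (blockTwist (U ω) (W (b ω)))}
      ≤ P.real {ω | (η * n) ^ (2 * k) ≤ T (b ω)} := measureReal_mono hsub
    _ = (edgeLaw n p q).real {x | (η * n) ^ (2 * k) ≤ T x} :=
        hb.measureReal_eq (p := fun x => (η * n) ^ (2 * k) ≤ T x) (Set.toFinite _).measurableSet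
    _ ≤ d * (n * (8 * k * n * r) ^ k) / (η * n) ^ (2 * k) := by
        rw [le_div_iff₀ hpos, mul_comm]
        exact hmarkov.trans hint
    _ = d * (n * (8 * k * r / (η ^ 2 * n)) ^ k) := by
        rw [pow_mul, mul_div_assoc, mul_div_assoc, ← div_pow]
        congr 3
        field_simp

/-- The growth hypothesis in the form used below: `r log n = o(n)` for `r = 1 / (p q)`. One of the
two logarithms is given away. -/
theorem eventually_inv_mul_log_le {p q : ℕ → unitInterval}
    (hpq : (fun n : ℕ => Real.log n ^ (2 : ℝ) / (n : ℝ)) =o[atTop]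
      (fun n : ℕ => (p n : ℝ) * (q n : ℝ))) {κ : ℝ} (hκ : 0 < κ) :
    ∀ᶠ n : ℕ in atTop, 0 < (p n * q n : ℝ) ∧ 1 ≤ Real.log n ∧
      1 / (p n * q n : ℝ) * Real.log n ≤ κ * n := by
  have hlog : ∀ᶠ n : ℕ in atTop, 1 ≤ Real.log n :=
    (Real.tendsto_log_atTop.comp tendsto_natCast_atTop_atTop).eventually_ge_atTop 1
  filter_upwards [hpq.def hκ, hlog, eventually_gt_atTop 0] with n h1 h2 h3
  have hn : (0 : ℝ) < n := by exact_mod_cast h3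
  have hρ : (0 : ℝ) ≤ p n * q n := mul_nonneg (p n).2.1 (q n).2.1
  rw [Real.rpow_two, Real.norm_of_nonneg (by positivity), Real.norm_of_nonneg hρ,
    div_le_iff₀ hn] at h1
  have hpos : 0 < (p n * q n : ℝ) := by
    refine lt_of_le_of_ne hρ fun h0 => ?_
    rw [← h0, mul_zero, zero_mul] at h1
    nlinarith
  refine ⟨hpos, h2, ?_⟩
  rw [one_div_mul_eq_div, div_le_iff₀ hpos]
  nlinarith

/-- The Borel–Cantelli lemma, with the tail bound for moments of order about `log n`. -/
theorem ae_eventually_opNorm_lt {d : ℕ} {p q : ℕ → unitInterval} {Ω : Type*} [MeasurableSpace Ω]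
    {P : Measure Ω} [IsProbabilityMeasure P] {b : ∀ n, Ω → Edge n → Bool × Bool}
    (hb : ∀ n, HasLaw (b n) (edgeLaw n (p n) (q n)) P)
    (U : ∀ n, Ω → Fin n → Matrix.unitaryGroup (Fin d) ℂ)
    (hpq : (fun n : ℕ => Real.log n ^ (2 : ℝ) / (n : ℝ)) =o[atTop]
      (fun n : ℕ => (p n : ℝ) * (q n : ℝ))) {η : ℝ} (hη : 0 < η) :
    ∀ᵐ ω ∂P, ∀ᶠ n : ℕ in atTop, opNorm (blockTwist (U n ω)
      (edgeMatrix fun a => centredWeight (1 / (p n * q n)) (b n ω a))) < η * n := by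
  set S : ℕ → Set Ω := fun n => {ω | η * n ≤ opNorm (blockTwist (U n ω)
    (edgeMatrix fun a => centredWeight (1 / (p n * q n)) (b n ω a)))} with hS
  have hsum : Summable fun n => P.real (S n) := by
    have hdom : Summable fun n : ℕ => (d : ℝ) * (1 / (n : ℝ) ^ 2) :=
      (Real.summable_one_div_nat_pow.2 one_lt_two).mul_left _
    refine Summable.of_norm_bounded_eventually_nat hdom ?_
    obtain ⟨κ, hκ, hκ4, hκη⟩ : ∃ κ : ℝ, 0 < κ ∧ κ ≤ 1 / 4 ∧ κ ≤ η ^ 2 / 16 * Real.exp (-3) :=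
      ⟨min (1 / 4) (η ^ 2 / 16 * Real.exp (-3)), by positivity, min_le_left _ _, min_le_right _ _⟩
    filter_upwards [eventually_inv_mul_log_le hpq hκ, eventually_gt_atTop 0]
      with n ⟨hρ, hlog, hr⟩ hn0
    have hn : (0 : ℝ) < n := by exact_mod_cast hn0
    set r : ℝ := 1 / (p n * q n) with hrdef
    have hr0 : 0 < r := by positivity
    -- `k ≥ log n` turns the factor `exp (-3)` into `n ^ (-3)`
    set k : ℕ := ⌈Real.log n⌉₊ with hkdef
    have hk1 : Real.log n ≤ k := Nat.le_ceil _
    have hk2 : (k : ℝ) ≤ 2 * Real.log n := by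
      have := Nat.ceil_lt_add_one (zero_le_one.trans hlog)
      linarith
    have hk : k ≠ 0 := by
      exact (Nat.ceil_pos.2 (by linarith)).ne'
    have hkr : k * r ≤ 2 * (κ * n) := by nlinarith
    have hκ1 : κ * n ≤ 1 / 4 * n := by gcongr
    have hκ2 : κ * n ≤ η ^ 2 / 16 * Real.exp (-3) * n := by gcongr
    have hratio : 8 * k * r / (η ^ 2 * n) ≤ Real.exp (-3) := by
      rw [div_le_iff₀ (by positivity)]
      linarith
    rw [Real.norm_of_nonneg (measureReal_nonneg (μ := P))]
    refine (measureReal_opNorm_ge_le (hb n) (U n) (mul_one_div_cancel hρ.ne') hk hn0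
      (by linarith) hη).trans ?_
    gcongr
    calc n * (8 * k * r / (η ^ 2 * n)) ^ k ≤ n * Real.exp (-3) ^ k := by gcongr
      _ = n * Real.exp (-3 * k) := by rw [← Real.exp_nat_mul]; ring_nf
      _ ≤ n * Real.exp (-3 * Real.log n) := by
          exact mul_le_mul_of_nonneg_left (Real.exp_le_exp.2 (by linarith)) hn.le
      _ = 1 / (n : ℝ) ^ 2 := by
          have : Real.exp (-3 * Real.log n) = ((n : ℝ) ^ 3)⁻¹ := by
            rw [neg_mul, Real.exp_neg, mul_comm, Real.exp_mul, Real.exp_log hn]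
            norm_cast
          rw [this]
          field_simp
  have hne : ∑' n, P (S n) ≠ ⊤ := by
    have := hsum.tsum_ofReal_ne_top
    simpa only [ofReal_measureReal (measure_ne_top P _)] using this
  filter_upwards [ae_eventually_notMem hne] with ω hω
  filter_upwards [hω] with n hn
  exact not_le.1 hn

end Tail

end GroupSync

end

theorem mainTheorem5 :
    ∃ c₀ : ℝ, 1 < c₀ ∧
      ∀ (G : Type*) [Group G] [TopologicalSpace G] [IsTopologicalGroup G] [CompactSpace G]
        [MeasurableSpace G] [BorelSpace G]
        (d : ℕ) (π : G →* Matrix.unitaryGroup (Fin d) ℂ) (_ : Continuous π)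
        (p q : ℕ → unitInterval) (σ : ℕ → ℝ) (_ : ∀ n, 0 ≤ σ n)
        (γ : Measure ℂ) (_ : γ = GroupSync.realGaussian ∨ γ = GroupSync.complexGaussian)
        (Ω : Type*) [MeasurableSpace Ω] (P : Measure Ω) [IsProbabilityMeasure P]
        (g : ∀ n : ℕ, Ω → Fin n → G)
        (e δ : ∀ n : ℕ, Ω → GroupSync.Edge n → Bool)
        (h : ∀ n : ℕ, Ω → GroupSync.Edge n → G)
        (ε : ∀ n : ℕ, Ω → GroupSync.Edge n → Fin d → Fin d → ℂ)
        (_ : ∀ n, Measurable (g n))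
        (_ : ∀ n, HasLaw (fun ω => (e n ω, δ n ω, h n ω, ε n ω))
          (GroupSync.corruptionLaw n d G (p n) (q n) γ) P)
        (_ : ∀ n, IndepFun (g n) (fun ω => (e n ω, δ n ω, h n ω, ε n ω)) P)
        (_ : (fun n : ℕ => Real.log n ^ c₀ / (n : ℝ)) =o[atTop]
          (fun n : ℕ => (p n : ℝ) * (q n : ℝ))),
        ∀ᵐ ω ∂P, Tendsto
          (fun n : ℕ => GroupSync.opNorm
            (GroupSync.Y₁ π (p n) (q n) (σ n) (g n ω) (e n ω) (δ n ω) (h n ω) (ε n ω)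
              - GroupSync.Y₂ π (p n) (q n) (σ n) (g n ω) (e n ω) (δ n ω) (h n ω) (ε n ω)))
          atTop (𝓝 0) := by
  refine ⟨2, one_lt_two, ?_⟩
  intro G _ _ _ _ _ _ d π _ p q σ _ γ hγ Ω _ P _ g e δ h ε _ hlaw _ hpq
  have hγ' : IsProbabilityMeasure γ := by
    rcases hγ with rfl | rfl <;> infer_instance
  have hae := fun j : ℕ => GroupSync.ae_eventually_opNorm_lt (d := d)
    (fun n => GroupSync.hasLaw_edgeLaw (hlaw n))
    (fun n ω i => π (g n ω i)) hpq (Nat.one_div_pos_of_nat (α := ℝ) (n := j))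
  filter_upwards [ae_all_iff.2 hae] with ω hω
  rw [Metric.tendsto_nhds]
  intro η hη
  obtain ⟨j, hj⟩ := exists_nat_one_div_lt (half_pos hη)
  filter_upwards [hω j, GroupSync.eventually_inv_mul_log_le hpq (half_pos hη),
    eventually_gt_atTop 0]
    with n h1 ⟨hρ, hlog, h2⟩ hn0
  have hn : (0 : ℝ) < n := by exact_mod_cast hn0
  have hr1 : 1 ≤ 1 / (p n * q n : ℝ) := by
    rw [le_div_iff₀ hρ, one_mul]
    exact mul_le_one₀ (p n).2.2 (q n).2.1 (q n).2.2
  -- the diagonal blocks of `Y₁ - Y₂` contribute `(r - 1) / n`, where `r = 1 / (p q) ≤ η n / 2`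
  have hdiag : GroupSync.opNorm
      (((1 / (p n * q n) - 1 : ℝ) : ℂ) • (1 : GroupSync.BlockMatrix n d)) ≤ η / 2 * n := by
    rw [GroupSync.opNorm_smul, Complex.norm_of_nonneg (by linarith)]
    nlinarith [GroupSync.opNorm_one_le (n := n) (d := d)]
  rw [GroupSync.Y₁_sub_Y₂, Real.dist_eq, sub_zero, GroupSync.opNorm_smul,
    Complex.norm_of_nonneg (by positivity), one_div_mul_eq_div,
    abs_of_nonneg (div_nonneg (GroupSync.opNorm_nonneg _) hn.le), div_lt_iff₀ hn]
  refine (GroupSync.opNorm_add_le _ _).trans_lt ?_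
  have h3 : 1 / ((j : ℝ) + 1) * n < η / 2 * n := by gcongr
  linarith
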